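/- A caterpillar is a tree $T$ such that removing all of its leaves (vertices of degree one) leaves a path, called the spine. A backbone of $T$ is a path $v_0, v_1, \dots, v_k, v_{k+1}$ in $T$ such that $v_1, \dots, v_k$ is the spine and $v_0, v_{k+1}$ are two leaves of $T$ (adjacent to $v_1$ and $v_k$, respectively). A graph is 1-planar if it can be drawn in the plane so that each edge has at most one crossing. A 1-planar packing of $n$-vertex graphs $G_1, \dots, G_m$ is an $n$-vertex 1-planar graph that contains (isomorphic copies of) $G_1, \dots, G_m$ as pairwise edge-disjoint spanning subgraphs. Theorem. Let $T$ be a caterpillar with $n$ vertices whose backbone contains exactly $4$ vertices (equivalently, whose spine has exactly two vertices), and let $P_1$ and $P_2$ be two paths with $n$ vertices. Then $P_1$, $P_2$ and $T$ admit a 1-planar packing if and only if $n \geq 6$ and $\deg_T(v) \leq n-3$ for every vertex $v$ of $T$. -/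

import Mathlib

open SimpleGraph

/-- A drawing of the graph `G` in the plane: the vertices are distinct points, each edge is a simple
(Jordan) arc joining the points of its two end-vertices, and no edge passes through a vertex
other than at its two ends. Only the values of `arc` on the edges of `G` are meaningful. -/
structure Drawing {V : Type*} (G : SimpleGraph V) where
  /-- the point representing a vertex -/
  point : V → ℝ × ℝ
  /-- the curve representing an edge -/
  arc : Sym2 V → unitInterval → ℝ × ℝ
  point_injective : Function.Injective point
  arc_continuous : ∀ e ∈ G.edgeSet, Continuous (arc e)
  arc_injective : ∀ e ∈ G.edgeSet, Function.Injective (arc e)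
  arc_ends : ∀ e ∈ G.edgeSet, s(arc e 0, arc e 1) = e.map point
  arc_avoids : ∀ e ∈ G.edgeSet, ∀ t ∈ Set.Ioo (0 : unitInterval) 1, ∀ v : V, arc e t ≠ point v

namespace Drawing

variable {V : Type*} {G : SimpleGraph V}

/-- The curve of `e` without its two ends. -/
def openArc (D : Drawing G) (e : Sym2 V) : Set (ℝ × ℝ) :=
  D.arc e '' Set.Ioo (0 : unitInterval) 1

/-- The crossings on the edge `e`: the pairs `(f, x)` of another edge `f` and a point `x` in
the interior of both curves (a point where two curves merely touch is counted as well). -/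
def crossings (D : Drawing G) (e : Sym2 V) : Set (Sym2 V × (ℝ × ℝ)) :=
  {c | c.1 ∈ G.edgeSet ∧ c.1 ≠ e ∧ c.2 ∈ D.openArc e ∧ c.2 ∈ D.openArc c.1}

/-- Every edge has at most one crossing. -/
def IsOnePlane (D : Drawing G) : Prop :=
  ∀ e ∈ G.edgeSet, (D.crossings e).Subsingleton

end Drawing

/-- A graph is 1-planar if it can be drawn in the plane so that each edge has at most one
crossing. -/
def IsOnePlanar {V : Type*} (G : SimpleGraph V) : Prop :=
  ∃ D : Drawing G, D.IsOnePlane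

/-- `H` is a packing of the graphs `G i`: it has them, up to isomorphism, as pairwise
edge-disjoint spanning subgraphs. -/
def IsPacking {ι V : Type*} (H : SimpleGraph V) (G : ι → SimpleGraph V) : Prop :=
  ∃ K : ι → SimpleGraph V,
    (∀ i, K i ≤ H) ∧ (∀ i, Nonempty (G i ≃g K i)) ∧
    Pairwise fun i j => Disjoint (K i).edgeSet (K j).edgeSet

/-- The graphs `G i` admit a 1-planar packing. -/
def AdmitsOnePlanarPacking {ι V : Type*} (G : ι → SimpleGraph V) : Prop :=
  ∃ H : SimpleGraph V, IsOnePlanar H ∧ IsPacking H G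

/-- The graph `G` is a path. -/
def IsPathGraph {V : Type*} (G : SimpleGraph V) : Prop :=
  ∃ n : ℕ, Nonempty (G ≃g pathGraph n)

/-- A leaf is a vertex of degree one. -/
def IsLeaf {V : Type*} (G : SimpleGraph V) [G.LocallyFinite] (v : V) : Prop :=
  G.degree v = 1

/-- The vertices that remain when all leaves are removed. -/
def spine {V : Type*} (T : SimpleGraph V) [T.LocallyFinite] : Set V :=
  {v | ¬ IsLeaf T v}

/-- A caterpillar is a tree such that removing all the leaves results in a path. -/
def IsCaterpillar {V : Type*} (T : SimpleGraph V) [T.LocallyFinite] : Prop :=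
  T.IsTree ∧ IsPathGraph (T.induce (spine T))

/-- The walk `p` is a backbone of `T`: a path from a leaf to another leaf whose interior vertices are
exactly the spine vertices. -/
def IsBackbone {V : Type*} (T : SimpleGraph V) [T.LocallyFinite] {a b : V} (p : T.Walk a b) :
    Prop :=
  p.IsPath ∧ IsLeaf T a ∧ IsLeaf T b ∧ a ≠ b ∧
    ∀ w, w ∈ p.support ↔ w = a ∨ w = b ∨ w ∈ spine T

/-! With two spine vertices, `T` is a double star: every vertex is adjacent to exactly one of the
hubs `u`, `w`, so `n = deg u + deg w`.

Necessity is a count. In a packing each vertex has a neighbour in either path, and these two differ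
from each other, from its neighbours in `T` and from itself; hence `deg + 3 ≤ n`. Applied to both
hubs this gives `n ≤ 2n - 6`, so `n ≥ 6`.

For sufficiency, both hubs have degree at least 3. Put `n = m + 2`, label the hubs `0` and `m + 1`,
the leaves at `m + 1` by `1, …, b` and those at `0` by `b + 1, …, m`. One 1-planar host graph serves
all cases (`HubEdge`): two hubs joined to everything, and the square of the path `1, …, m` together
with the edge from `1` to `m`. The first path is `0, 1, …, m + 1`; the second (`secondPath`) runs
through one parity class and then the other in steps of two, with a few exceptional edges.

The host is drawn with straight segments (`isOnePlanar_hubGraph`). The vertices `2, …, m` zigzag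
between `y = 0` and `y = 1`, one hub lies above and one below, and vertex `1` lies far to the right.
The segment from `j - 1` to `j + 1` is crossed only by the edge from `j` to the upper hub (`j` even)
or to the lower hub (`j` odd), and the edge from `1` to `m` only by the edge between the hubs. Every
other pair of edges is separated by an explicit line (`HubEdge.sep`). -/

/-! ### Separating lattice segments by lines. -/

/-- Some line with integer coefficients has the segments `pq` and `rs` on its two closed sides, and
does not contain both of them. -/
def LineSeparated (p q r s : ℤ × ℤ) : Prop :=
  ∃ α β γ : ℤ, α * p.1 + β * p.2 ≤ γ ∧ α * q.1 + β * q.2 ≤ γ ∧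
    γ ≤ α * r.1 + β * r.2 ∧ γ ≤ α * s.1 + β * s.2 ∧
    α * p.1 + β * p.2 + (α * q.1 + β * q.2) < α * r.1 + β * r.2 + (α * s.1 + β * s.2)

/-- The line through `p` and `q` does not contain the point `r`. -/
def OffLine (p q r : ℤ × ℤ) : Prop :=
  ∃ α β γ : ℤ, α * p.1 + β * p.2 = γ ∧ α * q.1 + β * q.2 = γ ∧ α * r.1 + β * r.2 ≠ γ

/-- The point of the real plane with the given integer coordinates. -/
def latticePoint (p : ℤ × ℤ) : ℝ × ℝ := (p.1, p.2)

lemma latticePoint_injective : Function.Injective latticePoint := by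
  rintro ⟨a, b⟩ ⟨c, d⟩ h
  simpa [latticePoint] using h

namespace LineSeparated

variable {p q r s : ℤ × ℤ}

lemma symm (h : LineSeparated p q r s) : LineSeparated r s p q := by
  obtain ⟨α, β, γ, h1, h2, h3, h4, h5⟩ := h
  exact ⟨-α, -β, -γ, by linarith, by linarith, by linarith, by linarith, by linarith⟩

lemma swap_right (h : LineSeparated p q r s) : LineSeparated p q s r := by
  obtain ⟨α, β, γ, h1, h2, h3, h4, h5⟩ := h
  exact ⟨α, β, γ, h1, h2, h4, h3, by linarith⟩

lemma swap_left (h : LineSeparated p q r s) : LineSeparated q p r s :=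
  h.symm.swap_right.symm

/-- The line through `p` and `q`, oriented so that `s` is strictly on its positive side, is itself
the separating line. -/
lemma of_det_ne_zero
    (h : (q.1 - p.1) * (s.2 - p.2) - (q.2 - p.2) * (s.1 - p.1) ≠ 0) :
    LineSeparated p q p s := by
  rcases lt_or_gt_of_ne h with h | h
  · refine ⟨q.2 - p.2, p.1 - q.1, (q.2 - p.2) * p.1 + (p.1 - q.1) * p.2, ?_, ?_, ?_, ?_, ?_⟩ <;>
      nlinarith
  · refine ⟨p.2 - q.2, q.1 - p.1, (p.2 - q.2) * p.1 + (q.1 - p.1) * p.2, ?_, ?_, ?_, ?_, ?_⟩ <;>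
      nlinarith

lemma of_det_ne_zero_swap
    (h : (q.1 - p.1) * (s.2 - p.2) - (q.2 - p.2) * (s.1 - p.1) ≠ 0) :
    LineSeparated q p q s :=
  of_det_ne_zero fun h' => h (by linear_combination -h')

lemma point_of_det_ne_zero
    (h : (q.1 - p.1) * (s.2 - p.2) - (q.2 - p.2) * (s.1 - p.1) ≠ 0) :
    LineSeparated p q s s := by
  rcases lt_or_gt_of_ne h with h | h
  · refine ⟨q.2 - p.2, p.1 - q.1, (q.2 - p.2) * p.1 + (p.1 - q.1) * p.2, ?_, ?_, ?_, ?_, ?_⟩ <;>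
      nlinarith
  · refine ⟨p.2 - q.2, q.1 - p.1, (p.2 - q.2) * p.1 + (q.1 - p.1) * p.2, ?_, ?_, ?_, ?_, ?_⟩ <;>
      nlinarith

/-- At a common point the linear form would be both at most and at least `γ`. As all weights in an
open segment are positive, it would equal `γ` at all four ends, against the strict inequality. -/
lemma disjoint (hpq : LineSeparated p q r s) :
    Disjoint (openSegment ℝ (latticePoint p) (latticePoint q))
      (openSegment ℝ (latticePoint r) (latticePoint s)) := by
  rw [Set.disjoint_left]
  rintro z ⟨a, b, ha, hb, hab, rfl⟩ ⟨c, d, hc, hd, hcd, h⟩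
  obtain ⟨α, β, γ, h1, h2, h3, h4, h5⟩ := hpq
  have hx : c * (r.1 : ℝ) + d * s.1 = a * p.1 + b * q.1 := congrArg Prod.fst h
  have hy : c * (r.2 : ℝ) + d * s.2 = a * p.2 + b * q.2 := congrArg Prod.snd h
  have e1 : (α * p.1 + β * p.2 : ℝ) ≤ γ := by exact_mod_cast h1
  have e2 : (α * q.1 + β * q.2 : ℝ) ≤ γ := by exact_mod_cast h2
  have e3 : (γ : ℝ) ≤ α * r.1 + β * r.2 := by exact_mod_cast h3
  have e4 : (γ : ℝ) ≤ α * s.1 + β * s.2 := by exact_mod_cast h4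
  have e5 : (α * p.1 + β * p.2 + (α * q.1 + β * q.2) : ℝ)
      < α * r.1 + β * r.2 + (α * s.1 + β * s.2) := by exact_mod_cast h5
  have key : a * (γ - (α * p.1 + β * p.2 : ℝ)) + b * (γ - (α * q.1 + β * q.2 : ℝ)) +
      (c * ((α * r.1 + β * r.2 : ℝ) - γ) + d * ((α * s.1 + β * s.2 : ℝ) - γ)) = 0 := by
    linear_combination (γ : ℝ) * hab - γ * hcd + α * hx + β * hy
  have k1 := mul_nonneg ha.le (sub_nonneg.2 e1)
  have k2 := mul_nonneg hb.le (sub_nonneg.2 e2)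
  have k3 := mul_nonneg hc.le (sub_nonneg.2 e3)
  have k4 := mul_nonneg hd.le (sub_nonneg.2 e4)
  have z1 : (γ - (α * p.1 + β * p.2 : ℝ)) = 0 :=
    (mul_eq_zero.1 (by linarith : a * (γ - (α * p.1 + β * p.2 : ℝ)) = 0)).resolve_left ha.ne'
  have z2 : (γ - (α * q.1 + β * q.2 : ℝ)) = 0 :=
    (mul_eq_zero.1 (by linarith : b * (γ - (α * q.1 + β * q.2 : ℝ)) = 0)).resolve_left hb.ne'
  have z3 : ((α * r.1 + β * r.2 : ℝ) - γ) = 0 :=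
    (mul_eq_zero.1 (by linarith : c * ((α * r.1 + β * r.2 : ℝ) - γ) = 0)).resolve_left hc.ne'
  have z4 : ((α * s.1 + β * s.2 : ℝ) - γ) = 0 :=
    (mul_eq_zero.1 (by linarith : d * ((α * s.1 + β * s.2 : ℝ) - γ) = 0)).resolve_left hd.ne'
  linarith

/-- The degenerate segment from `r` to `r` is the point `r`, so separation also expresses that an
edge avoids a vertex. -/
lemma notMem (h : LineSeparated p q r r) :
    latticePoint r ∉ openSegment ℝ (latticePoint p) (latticePoint q) := fun hr =>
  Set.disjoint_left.1 h.disjoint hr (by simp)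

end LineSeparated

/-- An affine form vanishing on the line `pq` but not at `r` has at most one zero along the segment
from `r` to `s`. -/
lemma OffLine.subsingleton {p q r s : ℤ × ℤ} (h : OffLine p q r) :
    (openSegment ℝ (latticePoint p) (latticePoint q) ∩
      openSegment ℝ (latticePoint r) (latticePoint s)).Subsingleton := by
  obtain ⟨α, β, γ, h1, h2, h3⟩ := h
  have e1 : (α * p.1 + β * p.2 : ℝ) = γ := by exact_mod_cast h1
  have e2 : (α * q.1 + β * q.2 : ℝ) = γ := by exact_mod_cast h2
  have e3 : (α * r.1 + β * r.2 : ℝ) - γ ≠ 0 := sub_ne_zero.2 (by exact_mod_cast h3)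
  have key : ∀ a b c d : ℝ, a + b = 1 → c + d = 1 →
      c • latticePoint r + d • latticePoint s = a • latticePoint p + b • latticePoint q →
      c * ((α * r.1 + β * r.2 : ℝ) - γ) + d * ((α * s.1 + β * s.2 : ℝ) - γ) = 0 := by
    intro a b c d hab hcd h
    have hx : c * (r.1 : ℝ) + d * s.1 = a * p.1 + b * q.1 := congrArg Prod.fst h
    have hy : c * (r.2 : ℝ) + d * s.2 = a * p.2 + b * q.2 := congrArg Prod.snd h
    linear_combination (γ : ℝ) * hab - γ * hcd + α * hx + β * hy + a * e1 + b * e2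
  rintro z ⟨⟨a, b, -, -, hab, rfl⟩, c, d, -, -, hcd, h⟩
    z' ⟨⟨a', b', -, -, hab', rfl⟩, c', d', -, -, hcd', h'⟩
  have k := key a b c d hab hcd h
  have k' := key a' b' c' d' hab' hcd' h'
  have : (d' - d) * ((α * r.1 + β * r.2 : ℝ) - γ) = 0 := by
    linear_combination d' * k - d * k' -
      ((α * r.1 + β * r.2 : ℝ) - γ) * (d' * hcd - d * hcd')
  have hd : d' = d := sub_eq_zero.1 ((mul_eq_zero.1 this).resolve_right e3)
  have hc : c' = c := by linarith
  rw [← h, ← h', hd, hc]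

/-! ### Coordinates of the straight-line layout. -/

/-- The upper hub. -/
def upperHub (m : ℕ) : ℤ × ℤ := (m + 1, 2 * m - 2)
/-- The lower hub. -/
def lowerHub (m : ℕ) : ℤ × ℤ := (m + 1, -m)
/-- The vertex of the strip that is placed to the right of both hubs. -/
def stripStart (m : ℕ) : ℤ × ℤ := (m + 2, 3 * m - 2)
/-- The other vertices of the strip. -/
def stripPoint (i : ℕ) : ℤ × ℤ := (i, (i % 2 : ℕ))

/-- The placement of the vertices `0, …, m + 1`. -/
def layout (m i : ℕ) : ℤ × ℤ :=
  if i = 0 then upperHub m else if i = m + 1 then lowerHub m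
  else if i = 1 then stripStart m else stripPoint i

lemma layout_zero (m : ℕ) : layout m 0 = upperHub m := by simp [layout]
lemma layout_last (m : ℕ) : layout m (m + 1) = lowerHub m := by simp [layout]
lemma layout_one {m : ℕ} (hm : 4 ≤ m) : layout m 1 = stripStart m := by
  unfold layout
  rw [if_neg (by omega), if_neg (by omega), if_pos rfl]
lemma layout_strip {m i : ℕ} (h2 : 2 ≤ i) (hi : i ≤ m) : layout m i = stripPoint i := by
  unfold layout
  rw [if_neg (by omega), if_neg (by omega), if_neg (by omega)]

/-! ### Separating lines for pairs of segments in the layout. -/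

section Separation

variable {m i j k l : ℕ}

lemma sep_upper_upper (hi : 2 ≤ i) (hij : i < j) (hj : j ≤ m) :
    ((upperHub m).1 - (stripPoint i).1) * ((stripPoint j).2 - (stripPoint i).2) -
      ((upperHub m).2 - (stripPoint i).2) * ((stripPoint j).1 - (stripPoint i).1) ≠ 0 := by
  simp only [upperHub, stripPoint]
  have h1 : ((i % 2 : ℕ) : ℤ) = 0 ∨ ((i % 2 : ℕ) : ℤ) = 1 := by omega
  have h2 : ((j % 2 : ℕ) : ℤ) = 0 ∨ ((j % 2 : ℕ) : ℤ) = 1 := by omega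
  have a1 : (2 : ℤ) ≤ i := by exact_mod_cast hi
  have a2 : (i : ℤ) + 1 ≤ j := by exact_mod_cast hij
  have a3 : (j : ℤ) ≤ m := by exact_mod_cast hj
  apply ne_of_lt
  rcases h1 with h1 | h1 <;> rcases h2 with h2 | h2 <;> rw [h1, h2] <;>
    nlinarith [mul_nonneg (by linarith : (0 : ℤ) ≤ j - i - 1) (by linarith : (0 : ℤ) ≤ 2 * m - 3)]

lemma sep_lower_lower (hi : 2 ≤ i) (hij : i < j) (hj : j ≤ m) :
    ((lowerHub m).1 - (stripPoint i).1) * ((stripPoint j).2 - (stripPoint i).2) -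
      ((lowerHub m).2 - (stripPoint i).2) * ((stripPoint j).1 - (stripPoint i).1) ≠ 0 := by
  simp only [lowerHub, stripPoint]
  have h1 : ((i % 2 : ℕ) : ℤ) = 0 ∨ ((i % 2 : ℕ) : ℤ) = 1 := by omega
  have h2 : ((j % 2 : ℕ) : ℤ) = 0 ∨ ((j % 2 : ℕ) : ℤ) = 1 := by omega
  have a1 : (2 : ℤ) ≤ i := by exact_mod_cast hi
  have a2 : (i : ℤ) + 1 ≤ j := by exact_mod_cast hij
  have a3 : (j : ℤ) ≤ m := by exact_mod_cast hj
  apply ne_of_gt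
  rcases h1 with h1 | h1 <;> rcases h2 with h2 | h2 <;> rw [h1, h2] <;>
    nlinarith [mul_nonneg (by linarith : (0 : ℤ) ≤ j - i - 1) (by linarith : (0 : ℤ) ≤ (m : ℤ))]

/-- Since `i - i % 2` and `i + i % 2` are monotone in `i`, either diagonal through a strip point has
the earlier strip points weakly on one side and the later ones weakly on the other. The upper hub is
above all these diagonals and the lower hub below them. The same lines serve for edges between a hub
and the strip and edges inside the strip. -/
lemma sep_upper_lower (hm : 4 ≤ m) (hi : 2 ≤ i) (him : i ≤ m) (hj : 2 ≤ j) (hjm : j ≤ m) :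
    LineSeparated (lowerHub m) (stripPoint j) (upperHub m) (stripPoint i) := by
  rcases lt_trichotomy i j with h | h | h
  · refine ⟨-1, 1, -(i - (i % 2 : ℕ) : ℤ), ?_⟩
    simp only [lowerHub, stripPoint, upperHub]
    omega
  · refine ⟨0, 1, (i % 2 : ℕ), ?_⟩
    simp only [lowerHub, stripPoint, upperHub]
    omega
  · refine ⟨1, 1, (i + (i % 2 : ℕ) : ℤ), ?_⟩
    simp only [lowerHub, stripPoint, upperHub]
    omega

lemma sep_upper_strip (hm : 4 ≤ m) (hi : 2 ≤ i) (him : i ≤ m)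
    (hjk : k = j + 1 ∨ k = j + 2) (hk : k ≤ m)
    (hne : ¬ (i % 2 = 0 ∧ i = j + 1 ∧ k = i + 1)) :
    LineSeparated (stripPoint j) (stripPoint k) (upperHub m) (stripPoint i) := by
  rcases le_or_gt i j with h | h
  · refine ⟨-1, 1, -(i - (i % 2 : ℕ) : ℤ), ?_⟩
    simp only [stripPoint, upperHub]
    omega
  rcases le_or_gt k i with h' | h'
  · refine ⟨1, 1, (i + (i % 2 : ℕ) : ℤ), ?_⟩
    simp only [stripPoint, upperHub]
    omega
  -- Here `i` is the midpoint index of `j`, `k` and is odd, so it lies on the upper side `y = 1` of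
  -- the strip.
  · refine ⟨0, 1, 1, ?_⟩
    simp only [stripPoint, upperHub]
    omega

lemma sep_lower_strip (hm : 4 ≤ m) (hi : 2 ≤ i) (him : i ≤ m)
    (hjk : k = j + 1 ∨ k = j + 2)
    (hne : ¬ (i % 2 = 1 ∧ i = j + 1 ∧ k = i + 1)) :
    LineSeparated (lowerHub m) (stripPoint i) (stripPoint j) (stripPoint k) := by
  rcases le_or_gt i j with h | h
  · refine ⟨1, 1, (i + (i % 2 : ℕ) : ℤ), ?_⟩
    simp only [stripPoint, lowerHub]
    omega
  rcases le_or_gt k i with h' | h'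
  · refine ⟨-1, 1, -(i - (i % 2 : ℕ) : ℤ), ?_⟩
    simp only [stripPoint, lowerHub]
    omega
  · refine ⟨0, 1, 0, ?_⟩
    simp only [stripPoint, lowerHub]
    omega

lemma sep_strip_strip (hj : j = i + 1 ∨ j = i + 2) (hl : l = k + 1 ∨ l = k + 2)
    (hne : ¬ (i = k ∧ j = l)) (hik : i ≤ k) :
    LineSeparated (stripPoint i) (stripPoint j) (stripPoint k) (stripPoint l) := by
  rcases le_or_gt j k with h | h
  · refine ⟨1, 0, k, ?_⟩
    simp only [stripPoint]
    omega
  have hh : ((i = k ∨ k + 1 = i) ∧ j = i + 1) ∨ (i = k ∧ j = i + 2) ∨ (k = i + 1 ∧ j = i + 2) := by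
    omega
  have : (l - k = 1 ∧ j = l + 1) ∨ (l - k = 1 ∧ j = l) ∨ (l - k = 2) := by omega
  -- The edges now overlap horizontally, so one of them has index difference two. It lies on a side
  -- `y = 0` or `y = 1` of the strip, and that side is the separating line.
  by_cases hp : (i % 2 = 0 ∧ j = i + 2) ∨ (k % 2 = 1 ∧ l = k + 2)
  · by_cases hp' : i % 2 = 0 ∧ j = i + 2
    · refine ⟨0, 1, 0, ?_⟩
      simp only [stripPoint]
      omega
    · refine ⟨0, 1, 1, ?_⟩
      simp only [stripPoint]
      omega
  · by_cases hp' : i % 2 = 1 ∧ j = i + 2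
    · refine ⟨0, -1, -1, ?_⟩
      simp only [stripPoint]
      omega
    · refine ⟨0, -1, 0, ?_⟩
      simp only [stripPoint]
      omega

lemma sep_right_left {p q r s : ℤ × ℤ}
    (hp : p = upperHub m ∨ p = lowerHub m ∨ p = stripStart m)
    (hq : q = upperHub m ∨ q = lowerHub m ∨ q = stripStart m)
    (hr : r.1 ≤ m + 1) (hs : s.1 ≤ m) :
    LineSeparated r s p q := by
  refine ⟨1, 0, m + 1, ?_⟩
  have : (m : ℤ) + 1 ≤ p.1 := by
    rcases hp with rfl | rfl | rfl <;> simp [upperHub, lowerHub, stripStart]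
  have : (m : ℤ) + 1 ≤ q.1 := by
    rcases hq with rfl | rfl | rfl <;> simp [upperHub, lowerHub, stripStart]
  omega

/-- The line of slope 5/2 through strip point 2 has all other strip points and both hubs strictly
below it, while vertex `1` is on or above it because `m ≥ 4`. -/
lemma sep_startTwo {r s : ℤ × ℤ} (hm : 4 ≤ m)
    (hr : r = upperHub m ∨ r = lowerHub m ∨ ∃ i, 2 ≤ i ∧ i ≤ m ∧ r = stripPoint i)
    (hs : s = upperHub m ∨ s = lowerHub m ∨ ∃ i, 3 ≤ i ∧ i ≤ m ∧ s = stripPoint i) :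
    LineSeparated r s (stripStart m) (stripPoint 2) := by
  refine ⟨-5, 2, -10, ?_⟩
  have h1 : -5 * r.1 + 2 * r.2 ≤ -10 := by
    rcases hr with rfl | rfl | ⟨i, h, h', rfl⟩ <;> simp only [upperHub, lowerHub, stripPoint] <;>
      omega
  have h2 : -5 * s.1 + 2 * s.2 < -10 := by
    rcases hs with rfl | rfl | ⟨i, h, h', rfl⟩ <;> simp only [upperHub, lowerHub, stripPoint] <;>
      omega
  simp only [stripStart, stripPoint]
  omega

/-- The line is `y = 3x - 8`, which contains both strip point 3 and vertex `1`. Strip point 2 is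
above it and the upper hub below it, which is why the edge from the upper hub to `2` is a genuine
crossing and is left out. -/
lemma sep_startThree {r s : ℤ × ℤ} (hm : 4 ≤ m)
    (hr : r = upperHub m ∨ r = lowerHub m ∨ ∃ i, 3 ≤ i ∧ i ≤ m ∧ r = stripPoint i)
    (hs : s = upperHub m ∨ s = lowerHub m ∨ ∃ i, 4 ≤ i ∧ i ≤ m ∧ s = stripPoint i) :
    LineSeparated r s (stripStart m) (stripPoint 3) := by
  refine ⟨-3, 1, -8, ?_⟩
  have h1 : -3 * r.1 + 1 * r.2 ≤ -8 := by
    rcases hr with rfl | rfl | ⟨i, h, h', rfl⟩ <;> simp only [upperHub, lowerHub, stripPoint] <;>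
      omega
  have h2 : -3 * s.1 + 1 * s.2 < -8 := by
    rcases hs with rfl | rfl | ⟨i, h, h', rfl⟩ <;> simp only [upperHub, lowerHub, stripPoint] <;>
      omega
  simp only [stripStart, stripPoint]
  omega

lemma sep_startThree_two {r : ℤ × ℤ} (hm : 4 ≤ m)
    (hr : r = lowerHub m ∨ r = stripPoint 2 ∨ r = stripPoint 3) :
    LineSeparated r (stripPoint 2) (stripStart m) (stripPoint 3) := by
  refine ⟨-1, 1, -2, ?_⟩
  rcases hr with rfl | rfl | rfl <;> simp only [stripStart, lowerHub, stripPoint] <;> omega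

lemma sep_startThree_twoFour (hm : 4 ≤ m) :
    LineSeparated (stripPoint 2) (stripPoint 4) (stripStart m) (stripPoint 3) := by
  refine ⟨0, 1, 0, ?_⟩
  simp only [stripStart, stripPoint]
  omega

lemma sep_startLast_left {r s : ℤ × ℤ} (hr : r.1 ≤ m) (hs : s.1 ≤ m) :
    LineSeparated r s (stripStart m) (stripPoint m) := by
  refine ⟨1, 0, m, ?_⟩
  simp only [stripStart, stripPoint]
  omega

/-- The separating line is the one through vertex `1` and strip point `m`. Its height at `x = m + 1`
is `(3m - 2 + m % 2) / 2`, which is below the upper hub when `m ≥ 4`. -/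
lemma sep_startLast_upper {r : ℤ × ℤ} (hm : 4 ≤ m)
    (hr : r = upperHub m ∨ ∃ i, 2 ≤ i ∧ i ≤ m ∧ r = stripPoint i) :
    LineSeparated (stripStart m) (stripPoint m) (upperHub m) r := by
  have h1 : ((m % 2 : ℕ) : ℤ) = 0 ∨ ((m % 2 : ℕ) : ℤ) = 1 := by omega
  have hm' : (4 : ℤ) ≤ m := by exact_mod_cast hm
  have aux : -(3 * m - 2 - (m % 2 : ℕ) : ℤ) * m + 2 * (m % 2 : ℕ) ≤
      -(3 * m - 2 - (m % 2 : ℕ) : ℤ) * r.1 + 2 * r.2 := by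
    rcases hr with rfl | ⟨i, h, h', rfl⟩
    · simp only [upperHub]
      rcases h1 with h1 | h1 <;> rw [h1] <;> nlinarith
    · rcases h'.eq_or_lt with rfl | h'
      · simp only [stripPoint]; rfl
      · have h2 : (0 : ℤ) ≤ (i % 2 : ℕ) := by omega
        have h3 : (i : ℤ) + 1 ≤ m := by exact_mod_cast h'
        simp only [stripPoint]
        rcases h1 with h1 | h1 <;> rw [h1] <;> nlinarith
  refine ⟨-(3 * m - 2 - (m % 2 : ℕ)), 2,
    -(3 * m - 2 - (m % 2 : ℕ)) * m + 2 * (m % 2 : ℕ), ?_, ?_, ?_, aux, ?_⟩ <;>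
    simp only [upperHub, stripStart, stripPoint]
  · apply le_of_eq; ring
  · rfl
  · rcases h1 with h1 | h1 <;> rw [h1] <;> nlinarith
  · rcases h1 with h1 | h1 <;> rw [h1] at aux ⊢ <;> nlinarith

lemma sep_startLast_lower (hm : 4 ≤ m) (hi : 2 ≤ i) (him : i ≤ m) :
    LineSeparated (lowerHub m) (stripPoint i) (stripStart m) (stripPoint m) := by
  refine ⟨1, 1, (i + (i % 2 : ℕ) : ℤ), ?_⟩
  simp only [lowerHub, stripPoint, stripStart]
  omega

lemma sep_startLast_lowerHub (hm : 4 ≤ m) :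
    LineSeparated (lowerHub m) (lowerHub m) (stripStart m) (stripPoint m) := by
  refine ⟨0, 1, 0, ?_⟩
  simp only [lowerHub, stripPoint, stripStart]
  omega

lemma sep_strip_point (hj : j = i + 1 ∨ j = i + 2) (hi : k ≠ i) (hkj : k ≠ j) :
    LineSeparated (stripPoint i) (stripPoint j) (stripPoint k) (stripPoint k) := by
  rcases lt_or_ge j k with h | h
  · refine ⟨1, 0, j, ?_⟩
    simp only [stripPoint]
    omega
  rcases lt_or_ge k i with h' | h'
  · refine ⟨-1, 0, -i, ?_⟩
    simp only [stripPoint]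
    omega
  rcases Nat.mod_two_eq_zero_or_one i with h2 | h2
  · refine ⟨0, 1, 0, ?_⟩
    simp only [stripPoint]
    omega
  · refine ⟨0, -1, -1, ?_⟩
    simp only [stripPoint]
    omega

/-- The points that are joined to the vertex `1` are seen from it in different directions. -/
lemma sep_start_start (hm : 4 ≤ m) {r s : ℤ × ℤ}
    (h : (r = stripPoint 2 ∧ (s = stripPoint 3 ∨ s = upperHub m ∨ s = lowerHub m ∨
      s = stripPoint m)) ∨
      (r = stripPoint 3 ∧ (s = upperHub m ∨ s = lowerHub m ∨ s = stripPoint m)) ∨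
      (r = stripPoint m ∧ (s = upperHub m ∨ s = lowerHub m)) ∨
      (r = upperHub m ∧ s = lowerHub m)) :
    LineSeparated (stripStart m) r (stripStart m) s := by
  apply LineSeparated.of_det_ne_zero
  have h1 : ((m % 2 : ℕ) : ℤ) = 0 ∨ ((m % 2 : ℕ) : ℤ) = 1 := by omega
  have hm' : (4 : ℤ) ≤ m := by exact_mod_cast hm
  rcases h with ⟨rfl, rfl | rfl | rfl | rfl⟩ | ⟨rfl, rfl | rfl | rfl⟩ | ⟨rfl, rfl | rfl⟩ |
    ⟨rfl, rfl⟩ <;> simp only [stripStart, stripPoint, upperHub, lowerHub] <;>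
    rcases h1 with h1 | h1 <;> (try rw [h1]) <;> norm_num <;>
    first
    | (apply ne_of_gt; nlinarith)
    | (apply ne_of_lt; nlinarith)

end Separation

/-! ### Edges of the hub graph and their crossings. -/

/-- For `i < j`: the vertices `i` and `j` of the drawn graph on `0, …, m + 1` are adjacent. The hubs
`0` and `m + 1` are joined to everything, and the other vertices form the square of a path together
with an edge between its two ends. -/
def HubEdge (m i j : ℕ) : Prop :=
  i < j ∧ j ≤ m + 1 ∧ (i = 0 ∨ j = m + 1 ∨ j = i + 1 ∨ j = i + 2 ∨ (i = 1 ∧ j = m))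

/-- The edges `ij` and `kl` cross in the drawing; the first one contains a hub. -/
def HubCrossing (m i j k l : ℕ) : Prop :=
  (i = 0 ∧ j % 2 = 0 ∧ 2 ≤ j ∧ j < m ∧ k + 1 = j ∧ l = j + 1) ∨
    (j = m + 1 ∧ i % 2 = 1 ∧ 3 ≤ i ∧ i < m ∧ k + 1 = i ∧ l = i + 1) ∨
    (i = 0 ∧ j = m + 1 ∧ k = 1 ∧ l = m)

/-- The edges `ij` and `kl` cross, or a line separates them. -/
def SepOrCrossing (m i j k l : ℕ) : Prop :=
  HubCrossing m i j k l ∨ HubCrossing m k l i j ∨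
    LineSeparated (layout m i) (layout m j) (layout m k) (layout m l)

section

variable {m i j k l : ℕ}

lemma SepOrCrossing.symm (h : SepOrCrossing m i j k l) : SepOrCrossing m k l i j := by
  rcases h with h | h | h
  · exact .inr (.inl h)
  · exact .inl h
  · exact .inr (.inr h.symm)

/-- Edges among the hubs and the vertex `1`. -/
def RightEdge (m i j : ℕ) : Prop :=
  (i = 0 ∧ j = 1) ∨ (i = 0 ∧ j = m + 1) ∨ (i = 1 ∧ j = m + 1)
/-- Edges from the upper hub to the strip. -/
def UpperEdge (m i j : ℕ) : Prop := i = 0 ∧ 2 ≤ j ∧ j ≤ m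
/-- Edges from the lower hub to the strip. -/
def LowerEdge (m i j : ℕ) : Prop := 2 ≤ i ∧ i ≤ m ∧ j = m + 1
/-- Edges in the strip. -/
def StripEdge (m i j : ℕ) : Prop := 2 ≤ i ∧ (j = i + 1 ∨ j = i + 2) ∧ j ≤ m
/-- Edges from the vertex `1` to the strip. -/
def StartEdge (m i j : ℕ) : Prop := i = 1 ∧ (j = 2 ∨ j = 3 ∨ j = m)

lemma HubEdge.cases (hm : 4 ≤ m) (h : HubEdge m i j) :
    RightEdge m i j ∨ UpperEdge m i j ∨ LowerEdge m i j ∨ StripEdge m i j ∨ StartEdge m i j := by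
  unfold HubEdge at h
  unfold RightEdge UpperEdge LowerEdge StripEdge StartEdge
  omega

lemma layout_right (hm : 4 ≤ m) (h : i = 0 ∨ i = 1 ∨ i = m + 1) :
    layout m i = upperHub m ∨ layout m i = lowerHub m ∨ layout m i = stripStart m := by
  rcases h with rfl | rfl | rfl
  · exact .inl (layout_zero m)
  · exact .inr (.inr (layout_one hm))
  · exact .inr (.inl (layout_last m))

lemma layout_fst_le (hi : i ≠ 1) (him : i ≤ m + 1) : (layout m i).1 ≤ m + 1 := by
  unfold layout
  split_ifs
  · simp [upperHub]
  · simp [lowerHub]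
  · simp only [stripPoint]; omega

lemma layout_fst_le_of_strip (hi : 2 ≤ i) (him : i ≤ m) : (layout m i).1 ≤ m := by
  rw [layout_strip hi him]
  simp only [stripPoint]; omega

lemma RightEdge.sep_left (hm : 4 ≤ m) (h : RightEdge m i j) (hk : k ≠ 1) (hkm : k ≤ m + 1)
    (hl : 2 ≤ l) (hlm : l ≤ m) :
    LineSeparated (layout m i) (layout m j) (layout m k) (layout m l) :=
  (sep_right_left (layout_right hm (by unfold RightEdge at h; omega))
    (layout_right hm (by unfold RightEdge at h; omega)) (layout_fst_le hk hkm)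
    (layout_fst_le_of_strip hl hlm)).symm

lemma lineSeparated_rightEdges (m : ℕ) :
    LineSeparated (stripStart m) (upperHub m) (upperHub m) (lowerHub m) ∧
    LineSeparated (stripStart m) (lowerHub m) (upperHub m) (lowerHub m) := by
  constructor <;> refine ⟨-1, 0, -(m + 1), ?_⟩ <;> simp only [stripStart, upperHub, lowerHub] <;>
    omega

lemma StartEdge.sep_right (hm : 4 ≤ m) (he : StartEdge m k l) (h : RightEdge m i j) :
    SepOrCrossing m i j k l := by
  obtain ⟨rfl, hl⟩ := he
  rcases h with ⟨rfl, rfl⟩ | ⟨rfl, rfl⟩ | ⟨rfl, rfl⟩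
  · refine .inr (.inr ?_)
    rw [layout_zero, layout_one hm]
    apply LineSeparated.swap_left
    apply LineSeparated.symm
    rcases hl with rfl | rfl | rfl <;> rw [layout_strip (by omega) (by omega)] <;>
      apply sep_start_start hm <;> simp
  · rcases hl with rfl | rfl | rfl
    · refine .inr (.inr ?_)
      rw [layout_zero, layout_one hm, layout_last, layout_strip (by omega) (by omega)]
      exact sep_startTwo hm (.inl rfl) (.inr (.inl rfl))
    · refine .inr (.inr ?_)
      rw [layout_zero, layout_one hm, layout_last, layout_strip (by omega) (by omega)]
      exact sep_startThree hm (.inl rfl) (.inr (.inl rfl))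
    · exact .inl (.inr (.inr ⟨rfl, rfl, rfl, rfl⟩))
  · refine .inr (.inr ?_)
    rw [layout_last, layout_one hm]
    apply LineSeparated.symm
    rcases hl with rfl | rfl | rfl <;> rw [layout_strip (by omega) (by omega)] <;>
      apply sep_start_start hm <;> simp

lemma RightEdge.sep_right (hm : 4 ≤ m) (he : RightEdge m i j) (hf : RightEdge m k l)
    (hne : ¬ (i = k ∧ j = l)) : SepOrCrossing m i j k l := by
  obtain ⟨h1, h2⟩ := lineSeparated_rightEdges m
  have h3 : LineSeparated (stripStart m) (upperHub m) (stripStart m) (lowerHub m) :=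
    sep_start_start hm (by simp)
  refine .inr (.inr ?_)
  rcases he with ⟨rfl, rfl⟩ | ⟨rfl, rfl⟩ | ⟨rfl, rfl⟩ <;>
  rcases hf with ⟨rfl, rfl⟩ | ⟨rfl, rfl⟩ | ⟨rfl, rfl⟩ <;>
  first
  | exact absurd ⟨rfl, rfl⟩ hne
  | simp only [layout_zero, layout_one hm, layout_last]
    first
    | exact h1.swap_left
    | exact h1.swap_left.symm
    | exact h2
    | exact h2.symm
    | exact h3.swap_left
    | exact h3.swap_left.symm

lemma RightEdge.sep (hm : 4 ≤ m) (he : RightEdge m i j) (hf : HubEdge m k l)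
    (hne : ¬ (i = k ∧ j = l)) : SepOrCrossing m i j k l := by
  rcases hf.cases hm with h | ⟨rfl, h⟩ | ⟨h1, h2, rfl⟩ | ⟨h1, h2, h3⟩ | h
  · exact he.sep_right hm h hne
  · exact .inr (.inr (he.sep_left hm (by omega) (by omega) h.1 h.2))
  · exact .inr (.inr (he.sep_left hm (by omega) (by omega) h1 h2).swap_right)
  · exact .inr (.inr (he.sep_left hm (by omega) (by omega) (by omega) (by omega)))
  · exact h.sep_right hm he

lemma UpperEdge.sep (hm : 4 ≤ m) (he : UpperEdge m i j)
    (hf : UpperEdge m k l ∨ LowerEdge m k l ∨ StripEdge m k l ∨ StartEdge m k l)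
    (hne : ¬ (i = k ∧ j = l)) : SepOrCrossing m i j k l := by
  obtain ⟨rfl, hj, hjm⟩ := he
  rcases hf with ⟨rfl, h1, h2⟩ | ⟨h1, h2, rfl⟩ | ⟨h1, h2, h3⟩ | ⟨rfl, h⟩
  · refine .inr (.inr ?_)
    rw [layout_zero, layout_strip hj hjm, layout_strip h1 h2]
    rcases lt_or_gt_of_ne (show j ≠ l from fun h => hne ⟨rfl, h⟩) with h | h
    · exact .of_det_ne_zero_swap (sep_upper_upper hj h h2)
    · exact (LineSeparated.of_det_ne_zero_swap (sep_upper_upper h1 h hjm)).symm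
  · refine .inr (.inr ?_)
    rw [layout_zero, layout_last, layout_strip hj hjm, layout_strip h1 h2]
    exact (sep_upper_lower hm hj hjm h1 h2).symm.swap_right
  · by_cases hc : j % 2 = 0 ∧ j = k + 1 ∧ l = j + 1
    · refine .inl (.inl ?_)
      omega
    · refine .inr (.inr ?_)
      rw [layout_zero, layout_strip hj hjm, layout_strip h1 (by omega),
        layout_strip (by omega) h3]
      exact (sep_upper_strip hm hj hjm h2 h3 hc).symm
  · rcases h with rfl | rfl | rfl
    · refine .inr (.inr ?_)
      rw [layout_zero, layout_one hm, layout_strip hj hjm, layout_strip (by omega) (by omega)]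
      exact (sep_startTwo hm (.inr (.inr ⟨j, hj, hjm, rfl⟩)) (.inl rfl)).swap_left
    · rcases hj.eq_or_lt with rfl | hj3
      · exact .inl (.inl ⟨rfl, rfl, le_rfl, by omega, rfl, rfl⟩)
      refine .inr (.inr ?_)
      rw [layout_zero, layout_one hm, layout_strip hj hjm, layout_strip (by omega) (by omega)]
      exact (sep_startThree hm (.inr (.inr ⟨j, hj3, hjm, rfl⟩)) (.inl rfl)).swap_left
    · refine .inr (.inr ?_)
      rw [layout_zero, layout_one hm, layout_strip hj hjm, layout_strip (by omega) (by omega)]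
      exact (sep_startLast_upper hm (.inr ⟨j, hj, hjm, rfl⟩)).symm

lemma LowerEdge.sep (hm : 4 ≤ m) (he : LowerEdge m i j)
    (hf : LowerEdge m k l ∨ StripEdge m k l ∨ StartEdge m k l)
    (hne : ¬ (i = k ∧ j = l)) : SepOrCrossing m i j k l := by
  obtain ⟨hi, him, rfl⟩ := he
  rcases hf with ⟨h1, h2, rfl⟩ | ⟨h1, h2, h3⟩ | ⟨rfl, h⟩
  · refine .inr (.inr ?_)
    rw [layout_last, layout_strip hi him, layout_strip h1 h2]
    apply LineSeparated.swap_left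
    apply LineSeparated.swap_right
    rcases lt_or_gt_of_ne (show i ≠ k from fun h => hne ⟨h, rfl⟩) with h | h
    · exact .of_det_ne_zero_swap (sep_lower_lower hi h h2)
    · exact (LineSeparated.of_det_ne_zero_swap (sep_lower_lower h1 h him)).symm
  · by_cases hc : i % 2 = 1 ∧ i = k + 1 ∧ l = i + 1
    · refine .inl (.inr (.inl ?_))
      omega
    · refine .inr (.inr ?_)
      rw [layout_last, layout_strip hi him, layout_strip h1 (by omega),
        layout_strip (by omega) h3]
      exact (sep_lower_strip hm hi him h2 hc).swap_left
  · refine .inr (.inr ?_)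
    rcases h with rfl | rfl | rfl
    · rw [layout_last, layout_one hm, layout_strip hi him, layout_strip (by omega) (by omega)]
      exact sep_startTwo hm (.inr (.inr ⟨i, hi, him, rfl⟩)) (.inr (.inl rfl))
    · rw [layout_last, layout_one hm, layout_strip hi him, layout_strip (by omega) (by omega)]
      rcases hi.eq_or_lt with rfl | hi3
      · exact (sep_startThree_two hm (.inl rfl)).swap_left
      · exact sep_startThree hm (.inr (.inr ⟨i, hi3, him, rfl⟩)) (.inr (.inl rfl))
    · rw [layout_last, layout_one hm, layout_strip hi him, layout_strip (by omega) (by omega)]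
      exact (sep_startLast_lower hm hi him).swap_left

lemma StripEdge.sep (hm : 4 ≤ m) (he : StripEdge m i j)
    (hf : StripEdge m k l ∨ StartEdge m k l)
    (hne : ¬ (i = k ∧ j = l)) : SepOrCrossing m i j k l := by
  refine .inr (.inr ?_)
  obtain ⟨hi, hj, hjm⟩ := he
  rw [layout_strip hi (by omega), layout_strip (by omega) hjm]
  rcases hf with ⟨h1, h2, h3⟩ | ⟨rfl, h⟩
  · rw [layout_strip h1 (by omega), layout_strip (by omega) h3]
    rcases le_total i k with h | h
    · exact sep_strip_strip hj h2 hne h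
    · exact (sep_strip_strip h2 hj (fun hh => hne ⟨hh.1.symm, hh.2.symm⟩) h).symm
  · rw [layout_one hm]
    rcases h with rfl | rfl | rfl
    · rw [layout_strip (by omega) (by omega)]
      exact sep_startTwo hm (.inr (.inr ⟨i, hi, by omega, rfl⟩))
        (.inr (.inr ⟨j, by omega, hjm, rfl⟩))
    · rw [layout_strip (by omega) (by omega)]
      rcases hi.eq_or_lt with rfl | hi3
      · rcases hj with rfl | rfl
        · exact (sep_startThree_two hm (.inr (.inr rfl))).swap_left
        · exact sep_startThree_twoFour hm
      · exact sep_startThree hm (.inr (.inr ⟨i, hi3, by omega, rfl⟩))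
          (.inr (.inr ⟨j, by omega, hjm, rfl⟩))
    · rw [layout_strip (by omega) (by omega)]
      apply sep_startLast_left <;> simp only [stripPoint] <;> omega

lemma StartEdge.sep (hm : 4 ≤ m) (he : StartEdge m i j) (hf : StartEdge m k l)
    (hne : ¬ (i = k ∧ j = l)) : SepOrCrossing m i j k l := by
  refine .inr (.inr ?_)
  obtain ⟨rfl, hj⟩ := he
  obtain ⟨rfl, hl⟩ := hf
  rw [layout_one hm, layout_strip (by omega) (by omega), layout_strip (by omega) (by omega)]
  rcases hj with rfl | rfl | rfl <;> rcases hl with rfl | rfl | rfl <;>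
  first
  | exact absurd ⟨rfl, rfl⟩ hne
  | (apply sep_start_start hm; simp; done)
  | (apply LineSeparated.symm; apply sep_start_start hm; simp)

/-- The lemmas for the five edge classes treat each unordered pair of classes in one order; symmetry
supplies the other. -/
lemma HubEdge.sep (hm : 4 ≤ m) (he : HubEdge m i j) (hf : HubEdge m k l)
    (hne : ¬ (i = k ∧ j = l)) : SepOrCrossing m i j k l := by
  have hne' : ¬ (k = i ∧ l = j) := fun h => hne ⟨h.1.symm, h.2.symm⟩
  rcases he.cases hm with h | h | h | h | h
  · exact h.sep hm hf hne
  all_goals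
    rcases hf.cases hm with h' | h' | h' | h' | h' <;>
    first
    | exact (h'.sep hm he hne').symm
    | exact h.sep hm (by tauto) hne
    | exact (h'.sep hm (by tauto) hne').symm

lemma HubEdge.sep_point (hm : 4 ≤ m) (he : HubEdge m i j) (hk : k ≤ m + 1) (hki : k ≠ i)
    (hkj : k ≠ j) : LineSeparated (layout m i) (layout m j) (layout m k) (layout m k) := by
  obtain ⟨h1, h2⟩ := lineSeparated_rightEdges m
  have hright : (k = 0 ∨ k = 1 ∨ k = m + 1) → i ≠ 1 → i ≤ m + 1 → 2 ≤ j → j ≤ m →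
      LineSeparated (layout m i) (layout m j) (layout m k) (layout m k) := fun h a b c d =>
    sep_right_left (layout_right hm h) (layout_right hm h) (layout_fst_le a b)
      (layout_fst_le_of_strip c d)
  rcases he.cases hm with h | ⟨rfl, h⟩ | ⟨hi, him, rfl⟩ | ⟨hi, hj, hjm⟩ | ⟨rfl, h⟩
  · by_cases hk2 : 2 ≤ k ∧ k ≤ m
    · exact h.sep_left hm (by omega) (by omega) hk2.1 hk2.2
    rcases h with ⟨rfl, rfl⟩ | ⟨rfl, rfl⟩ | ⟨rfl, rfl⟩
    · obtain rfl : k = m + 1 := by omega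
      rw [layout_zero, layout_one hm, layout_last]
      refine ⟨-1, 0, -(m + 1), ?_⟩
      simp only [stripStart, upperHub, lowerHub]
      omega
    · obtain rfl : k = 1 := by omega
      rw [layout_zero, layout_one hm, layout_last]
      refine ⟨1, 0, m + 1, ?_⟩
      simp only [stripStart, upperHub, lowerHub]
      omega
    · obtain rfl : k = 0 := by omega
      rw [layout_zero, layout_one hm, layout_last]
      refine ⟨-1, 0, -(m + 1), ?_⟩
      simp only [stripStart, upperHub, lowerHub]
      omega
  · by_cases hk2 : 2 ≤ k ∧ k ≤ m
    · rw [layout_zero, layout_strip h.1 h.2, layout_strip hk2.1 hk2.2]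
      rcases lt_or_gt_of_ne hkj with hl | hl
      · apply LineSeparated.point_of_det_ne_zero
        have := sep_upper_upper hk2.1 hl h.2
        contrapose! this
        linear_combination this
      · exact (LineSeparated.point_of_det_ne_zero (sep_upper_upper h.1 hl hk2.2)).swap_left
    · exact hright (by omega) (by omega) (by omega) h.1 h.2
  · by_cases hk2 : 2 ≤ k ∧ k ≤ m
    · rw [layout_last, layout_strip hi him, layout_strip hk2.1 hk2.2]
      rcases lt_or_gt_of_ne hki with hl | hl
      · apply LineSeparated.point_of_det_ne_zero
        have := sep_lower_lower hk2.1 hl him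
        contrapose! this
        linear_combination -this
      · exact LineSeparated.point_of_det_ne_zero (sep_lower_lower hi hl hk2.2)
    · have hr : k = 0 ∨ k = 1 ∨ k = m + 1 := by omega
      exact (sep_right_left (layout_right hm hr) (layout_right hm hr)
        (layout_fst_le (by omega) le_rfl) (layout_fst_le_of_strip hi him)).swap_left
  · by_cases hk2 : 2 ≤ k ∧ k ≤ m
    · rw [layout_strip hi (by omega), layout_strip (by omega) hjm, layout_strip hk2.1 hk2.2]
      exact sep_strip_point hj hki hkj
    · exact hright (by omega) (by omega) (by omega) (by omega) hjm
  · have hcase : k = 0 ∨ k = m + 1 ∨ (2 ≤ k ∧ k ≤ m) := by omega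
    rw [layout_one hm, layout_strip (by omega) (by omega)]
    apply LineSeparated.symm
    rcases h with rfl | rfl | rfl
    · rcases hcase with rfl | rfl | hk2
      · rw [layout_zero]
        exact sep_startTwo hm (.inl rfl) (.inl rfl)
      · rw [layout_last]
        exact sep_startTwo hm (.inr (.inl rfl)) (.inr (.inl rfl))
      · rw [layout_strip hk2.1 hk2.2]
        exact sep_startTwo hm (.inr (.inr ⟨k, hk2.1, hk2.2, rfl⟩))
          (.inr (.inr ⟨k, by omega, hk2.2, rfl⟩))
    · rcases hcase with rfl | rfl | hk2
      · rw [layout_zero]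
        exact sep_startThree hm (.inl rfl) (.inl rfl)
      · rw [layout_last]
        exact sep_startThree hm (.inr (.inl rfl)) (.inr (.inl rfl))
      · rw [layout_strip hk2.1 hk2.2]
        rcases hk2.1.eq_or_lt with rfl | hk3
        · exact sep_startThree_two hm (.inr (.inl rfl))
        · exact sep_startThree hm (.inr (.inr ⟨k, hk3, hk2.2, rfl⟩))
            (.inr (.inr ⟨k, by omega, hk2.2, rfl⟩))
    · rcases hcase with rfl | rfl | hk2
      · rw [layout_zero]
        exact (sep_startLast_upper hm (.inl rfl)).symm
      · rw [layout_last]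
        exact sep_startLast_lowerHub hm
      · rw [layout_strip hk2.1 hk2.2]
        apply sep_startLast_left <;> simp only [stripPoint] <;> omega

/-- Edges that cross meet only once, because one end of the edge with a hub is off the line of the
other edge. -/
lemma HubCrossing.offLine (hm : 4 ≤ m) (h : HubCrossing m i j k l) :
    OffLine (layout m k) (layout m l) (layout m i) := by
  rcases h with ⟨rfl, h1, h2, h3, h4, rfl⟩ | ⟨rfl, h1, h2, h3, h4, rfl⟩ | ⟨rfl, rfl, rfl, rfl⟩
  · rw [layout_zero]
    rcases h2.eq_or_lt with rfl | h2
    · obtain rfl : k = 1 := by omega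
      rw [layout_one hm, layout_strip (by omega) (by omega)]
      -- The line `y = 3x - 8` through vertex `1` and strip point 3.
      refine ⟨-3, 1, -8, ?_⟩
      simp only [stripStart, stripPoint, upperHub]
      omega
    · rw [layout_strip (by omega) (by omega), layout_strip (by omega) (by omega)]
      refine ⟨0, 1, 1, ?_⟩
      simp only [stripPoint, upperHub]
      omega
  · rw [layout_strip (by omega) (by omega), layout_strip (by omega) (by omega),
      layout_strip (by omega) (by omega)]
    refine ⟨0, 1, 0, ?_⟩
    simp only [stripPoint]
    omega
  · rw [layout_zero, layout_one hm, layout_strip (by omega) le_rfl]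
    refine ⟨-(3 * l - 2 - (l % 2 : ℕ)), 2, -(3 * l - 2 - (l % 2 : ℕ)) * l + 2 * (l % 2 : ℕ),
      ?_, ?_, ?_⟩ <;> simp only [stripStart, stripPoint, upperHub]
    · ring
    · apply ne_of_gt
      have : ((l % 2 : ℕ) : ℤ) ≤ 1 := by omega
      have : (4 : ℤ) ≤ l := by exact_mod_cast hm
      nlinarith

lemma layout_injOn (hi : i ≤ m + 1) (hj : j ≤ m + 1) (hm : 4 ≤ m)
    (h : layout m i = layout m j) : i = j := by
  have h1 := congrArg Prod.fst h
  have h2 := congrArg Prod.snd h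
  unfold layout at h1 h2
  split_ifs at h1 h2 <;> simp only [upperHub, lowerHub, stripStart, stripPoint] at h1 h2 <;> omega

end

/-! ### From straight-line placements to 1-planarity. -/

/-- The straight-line drawing with the given positions of the vertices. -/
noncomputable def straightDrawing {V : Type*} (G : SimpleGraph V) (pos : V → ℝ × ℝ)
    (hinj : Function.Injective pos)
    (havoid : ∀ a b v, G.Adj a b → v ≠ a → v ≠ b → pos v ∉ openSegment ℝ (pos a) (pos b)) :
    Drawing G where
  point := pos
  -- The orientation of the edge is an arbitrary choice; the open segment does not depend on it.
  arc e t := AffineMap.lineMap (pos e.out.1) (pos e.out.2) (t : ℝ)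
  point_injective := hinj
  arc_continuous e _ := by
    exact (AffineMap.lineMap_continuous).comp continuous_subtype_val
  arc_injective e he := by
    have hne : e.out.1 ≠ e.out.2 := by
      rw [← Quot.out_eq e] at he
      exact G.ne_of_adj he
    exact (AffineMap.lineMap_injective ℝ (hinj.ne hne)).comp Subtype.val_injective
  arc_ends e _ := by
    have h : Sym2.map pos s(e.out.1, e.out.2) = Sym2.map pos e := congrArg _ (Quot.out_eq e)
    simpa using h
  arc_avoids e he t ht v h := by
    rw [← Quot.out_eq e] at he
    have hadj : G.Adj e.out.1 e.out.2 := he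
    have hmem : pos v ∈ openSegment ℝ (pos e.out.1) (pos e.out.2) := by
      rw [openSegment_eq_image_lineMap]
      exact ⟨t, ⟨by exact_mod_cast ht.1, by exact_mod_cast ht.2⟩, h⟩
    by_cases h1 : v = e.out.1
    · subst h1
      rw [left_mem_openSegment_iff] at hmem
      exact hadj.ne (hinj hmem)
    by_cases h2 : v = e.out.2
    · subst h2
      rw [right_mem_openSegment_iff] at hmem
      exact hadj.ne (hinj hmem)
    exact havoid _ _ _ hadj h1 h2 hmem

lemma straightDrawing_openArc {V : Type*} {G : SimpleGraph V} {pos : V → ℝ × ℝ}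
    (hinj : Function.Injective pos)
    (havoid : ∀ a b v, G.Adj a b → v ≠ a → v ≠ b → pos v ∉ openSegment ℝ (pos a) (pos b))
    (a b : V) :
    (straightDrawing G pos hinj havoid).openArc s(a, b) = openSegment ℝ (pos a) (pos b) := by
  have key : ∀ e : Sym2 V, (straightDrawing G pos hinj havoid).openArc e =
      openSegment ℝ (pos e.out.1) (pos e.out.2) := by
    intro e
    rw [openSegment_eq_image_lineMap]
    ext x
    constructor
    · rintro ⟨t, ht, rfl⟩
      exact ⟨t, ⟨by exact_mod_cast ht.1, by exact_mod_cast ht.2⟩, rfl⟩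
    · rintro ⟨t, ht, rfl⟩
      exact ⟨⟨t, ht.1.le, ht.2.le⟩, ⟨by exact_mod_cast ht.1, by exact_mod_cast ht.2⟩, rfl⟩
  rw [key]
  have h : s((Quot.out s(a, b)).1, (Quot.out s(a, b)).2) = s(a, b) := Quot.out_eq s(a, b)
  rcases Sym2.eq_iff.1 h with ⟨h1, h2⟩ | ⟨h1, h2⟩
  · rw [h1, h2]
  · rw [h1, h2, openSegment_symm]

lemma isOnePlanar_of_straight {V : Type*} {G : SimpleGraph V} (pos : V → ℝ × ℝ)
    (hinj : Function.Injective pos)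
    (havoid : ∀ a b v, G.Adj a b → v ≠ a → v ≠ b → pos v ∉ openSegment ℝ (pos a) (pos b))
    (cross : Sym2 V → Sym2 V → Prop)
    (hdisj : ∀ a b c d, G.Adj a b → G.Adj c d → s(a, b) ≠ s(c, d) → ¬ cross s(a, b) s(c, d) →
      Disjoint (openSegment ℝ (pos a) (pos b)) (openSegment ℝ (pos c) (pos d)))
    (hone : ∀ a b c d, G.Adj a b → G.Adj c d → cross s(a, b) s(c, d) →
      (openSegment ℝ (pos a) (pos b) ∩ openSegment ℝ (pos c) (pos d)).Subsingleton)
    (huniq : ∀ e f g, e ∈ G.edgeSet → f ∈ G.edgeSet → g ∈ G.edgeSet →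
      cross e f → cross e g → f = g) :
    IsOnePlanar G := by
  refine ⟨straightDrawing G pos hinj havoid, ?_⟩
  have key : ∀ e f x, e ∈ G.edgeSet → f ∈ G.edgeSet → f ≠ e →
      x ∈ (straightDrawing G pos hinj havoid).openArc e →
      x ∈ (straightDrawing G pos hinj havoid).openArc f → cross e f := by
    intro e f x he hf hne hx hx'
    induction e with | _ a b
    induction f with | _ c d
    rw [straightDrawing_openArc] at hx hx'
    by_contra hc
    exact Set.disjoint_left.1 (hdisj a b c d he hf hne.symm hc) hx hx'
  rintro e he ⟨f, x⟩ ⟨hf, hfe, hx, hx'⟩ ⟨g, y⟩ ⟨hg, hge, hy, hy'⟩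
  have h1 := key e f x he hf hfe hx hx'
  have h2 := key e g y he hg hge hy hy'
  obtain rfl : f = g := huniq e f g he hf hg h1 h2
  simp only at hx hx' hy hy' hf
  induction e with | _ a b
  induction f with | _ c d
  rw [straightDrawing_openArc] at hx hx' hy hy'
  rw [hone a b c d he hf h1 ⟨hx, hx'⟩ ⟨hy, hy'⟩]

/-- The graph given by `HubEdge` on vertices labelled by natural numbers. -/
def hubGraph {V : Type*} (m : ℕ) (φ : V → ℕ) : SimpleGraph V where
  Adj a b := HubEdge m (φ a) (φ b) ∨ HubEdge m (φ b) (φ a)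
  symm := ⟨fun _ _ h => h.symm⟩
  loopless := ⟨fun _ h => by rcases h with h | h <;> exact lt_irrefl _ h.1⟩

lemma hubGraph_exists_rep {V : Type*} {m : ℕ} {φ : V → ℕ} {a b : V}
    (h : (hubGraph m φ).Adj a b) :
    ∃ i j : V, s(a, b) = s(i, j) ∧ HubEdge m (φ i) (φ j) := by
  rcases h with h | h
  · exact ⟨a, b, rfl, h⟩
  · exact ⟨b, a, Sym2.eq_swap, h⟩

lemma isOnePlanar_hubGraph {V : Type*} {m : ℕ} (hm : 4 ≤ m) {φ : V → ℕ}
    (hφ : Function.Injective φ) (hle : ∀ v, φ v ≤ m + 1) : IsOnePlanar (hubGraph m φ) := by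
  set pos : V → ℝ × ℝ := fun v => latticePoint (layout m (φ v)) with hpos
  have hseg : ∀ a b i j : V, s(a, b) = s(i, j) →
      openSegment ℝ (pos a) (pos b) = openSegment ℝ (pos i) (pos j) := by
    intro a b i j h
    rcases Sym2.eq_iff.1 h with ⟨rfl, rfl⟩ | ⟨rfl, rfl⟩
    · rfl
    · rw [openSegment_symm]
  refine isOnePlanar_of_straight pos
    (fun a b h => hφ (layout_injOn (hle a) (hle b) hm (latticePoint_injective h))) ?_
    (fun e f => ∃ i j k l : V, e = s(i, j) ∧ f = s(k, l) ∧ φ i < φ j ∧ φ k < φ l ∧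
      (HubCrossing m (φ i) (φ j) (φ k) (φ l) ∨ HubCrossing m (φ k) (φ l) (φ i) (φ j)))
    ?_ ?_ ?_
  · intro a b v hab hva hvb
    obtain ⟨i, j, hij, he⟩ := hubGraph_exists_rep hab
    rw [hseg a b i j hij]
    have hv : v ≠ i ∧ v ≠ j := by
      rcases Sym2.eq_iff.1 hij with ⟨rfl, rfl⟩ | ⟨rfl, rfl⟩ <;> exact ⟨‹_›, ‹_›⟩
    exact (he.sep_point hm (hle v) (hφ.ne hv.1) (hφ.ne hv.2)).notMem
  · intro a b c d hab hcd hne hcr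
    obtain ⟨i, j, hij, he⟩ := hubGraph_exists_rep hab
    obtain ⟨k, l, hkl, hf⟩ := hubGraph_exists_rep hcd
    rw [hseg a b i j hij, hseg c d k l hkl]
    have hne' : ¬ (φ i = φ k ∧ φ j = φ l) := by
      rintro ⟨h1, h2⟩
      apply hne
      rw [hij, hkl, hφ h1, hφ h2]
    rcases he.sep hm hf hne' with h | h | h
    · exact absurd ⟨i, j, k, l, hij, hkl, he.1, hf.1, .inl h⟩ hcr
    · exact absurd ⟨i, j, k, l, hij, hkl, he.1, hf.1, .inr h⟩ hcr
    · exact h.disjoint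
  · rintro a b c d - - ⟨i, j, k, l, hij, hkl, -, -, h⟩
    rw [hseg a b i j hij, hseg c d k l hkl]
    rcases h with h | h
    · rw [Set.inter_comm]
      exact (h.offLine hm).subsingleton
    · exact (h.offLine hm).subsingleton
  · rintro _ _ _ - - - ⟨i, j, k, l, rfl, rfl, hij, hkl, h⟩ ⟨i', j', k', l', he, rfl, hij', hkl', h'⟩
    rcases Sym2.eq_iff.1 he with ⟨rfl, rfl⟩ | ⟨rfl, rfl⟩
    -- A spoke to `j` can only cross the segment from `j - 1` to `j + 1`. Conversely, the parity of
    -- `j` tells which hub's spoke crosses that segment. As `m ≥ 4`, the edge from `1` to `m` is not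
    -- of this form.
    · have : φ k = φ k' ∧ φ l = φ l' := by
        unfold HubCrossing at h h'
        omega
      rw [hφ this.1, hφ this.2]
    -- Both representations list the smaller label first, so they cannot be reversed.
    · omega

/-! ### Packing two paths and a double star into the hub graph. -/

/-- The `t`-th vertex of a Hamiltonian path of the hub graph that complements the path
`0, 1, …, m + 1`. -/
def secondPath (m t : ℕ) : ℕ :=
  if m % 2 = 0 then (if 2 * t ≤ m then 2 * t else 2 * t - m - 1)
  else if 2 * t ≤ m + 1 then m + 1 - 2 * t else if t = m + 1 then 1 else 2 * t - m

/-- The edges of the double star with hubs `0` and `m + 1` in which the leaves `1, …, b` are attached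
to `m + 1` and the others to `0`. -/
def StarEdge (m b i j : ℕ) : Prop :=
  (i = 0 ∧ j = m + 1) ∨ (i = 0 ∧ b < j) ∨ (j = m + 1 ∧ 1 ≤ i ∧ i ≤ b)

section

variable {m b t t' : ℕ}

lemma secondPath_le (ht : t ≤ m + 1) : secondPath m t ≤ m + 1 := by
  unfold secondPath
  split_ifs <;> omega

lemma secondPath_inj (ht : t ≤ m + 1) (ht' : t' ≤ m + 1)
    (h : secondPath m t = secondPath m t') : t = t' := by
  unfold secondPath at h
  split_ifs at h <;> omega

/-- For even `m` the path is `0, 2, …, m, 1, 3, …, m - 1, m + 1`; for odd `m` it is `m + 1, m - 1,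
…, 2, 0, 3, 5, …, m, 1`. Its edges at the hubs lead from `0` to `2` and from `m + 1` to `m - 1`, and
for odd `m` also from `0` to `3`. They avoid the star because `2 ≤ b < m - 1`, and `3 ≤ b` in the
odd case. -/
lemma secondPath_succ (hm : 4 ≤ m) (hb : 2 ≤ b) (hbm : b + 2 ≤ m) (hpar : m % 2 = 0 ∨ 3 ≤ b)
    (ht : t + 1 ≤ m + 1) {i j : ℕ} (hi : i = secondPath m t) (hj : j = secondPath m (t + 1)) :
    (HubEdge m i j ∨ HubEdge m j i) ∧ i + 1 ≠ j ∧ j + 1 ≠ i ∧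
      ¬ StarEdge m b i j ∧ ¬ StarEdge m b j i := by
  unfold secondPath at hi hj
  unfold HubEdge StarEdge
  split_ifs at hi hj <;> omega

end

lemma IsPathGraph.nonempty_iso {V : Type*} [Fintype V] {P : SimpleGraph V} (h : IsPathGraph P) :
    Nonempty (P ≃g pathGraph (Fintype.card V)) := by
  obtain ⟨n, ⟨e⟩⟩ := h
  obtain rfl : Fintype.card V = n := by simpa using Fintype.card_congr e.toEquiv
  exact ⟨e⟩

lemma IsPathGraph.exists_adj {V : Type*} [Fintype V] {P : SimpleGraph V} (h : IsPathGraph P)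
    (hV : 2 ≤ Fintype.card V) (v : V) : ∃ w, P.Adj v w := by
  obtain ⟨e⟩ := h.nonempty_iso
  have hlt := (e v).2
  have : ∃ i, (pathGraph (Fintype.card V)).Adj (e v) i := by
    by_cases h0 : (e v).1 = 0
    · exact ⟨⟨1, hV⟩, pathGraph_adj.2 (.inl (by simp [h0]))⟩
    · exact ⟨⟨(e v).1 - 1, by omega⟩, pathGraph_adj.2 (.inr (by simp; omega))⟩
  obtain ⟨i, hi⟩ := this
  exact ⟨e.symm i, e.map_adj_iff.1 (by simpa using hi)⟩

lemma disjoint_edgeSet_iff {V : Type*} {G H : SimpleGraph V} :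
    Disjoint G.edgeSet H.edgeSet ↔ ∀ a b, G.Adj a b → ¬ H.Adj a b := by
  rw [Set.disjoint_left]
  exact ⟨fun h a b hab => h (a := s(a, b)) hab, fun h e => by
    induction e with | _ a b
    exact h a b⟩

/-- Two paths and a labelled double star have a packing into the hub graph. -/
lemma admitsOnePlanarPacking_of_labels {V : Type*} [Fintype V] {m b : ℕ} (hm : 4 ≤ m)
    (hb : 2 ≤ b) (hbm : b + 2 ≤ m) (hpar : m % 2 = 0 ∨ 3 ≤ b) (hV : Fintype.card V = m + 2)
    {φ : V → ℕ} (hφ : Function.Injective φ) (hle : ∀ v, φ v ≤ m + 1) {P₁ P₂ T : SimpleGraph V}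
    (hP₁ : IsPathGraph P₁) (hP₂ : IsPathGraph P₂)
    (hT : ∀ x y, T.Adj x y → StarEdge m b (φ x) (φ y) ∨ StarEdge m b (φ y) (φ x)) :
    AdmitsOnePlanarPacking ![P₁, P₂, T] := by
  obtain ⟨e₁⟩ := hP₁.nonempty_iso
  obtain ⟨e₂⟩ := hP₂.nonempty_iso
  rw [hV] at e₁ e₂
  let φ' : V ≃ Fin (m + 2) := Equiv.ofBijective (fun v => ⟨φ v, by have := hle v; omega⟩) <| by
    rw [Fintype.bijective_iff_injective_and_card]
    exact ⟨fun x y h => hφ (Fin.mk.inj h), by simpa using hV⟩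
  let σ : Fin (m + 2) ≃ Fin (m + 2) := Equiv.ofBijective
    (fun t => ⟨secondPath m t, by have := secondPath_le (m := m) (t := t) (by omega); omega⟩) <| by
    rw [Fintype.bijective_iff_injective_and_card]
    exact ⟨fun x y h => Fin.ext (secondPath_inj (by omega) (by omega) (Fin.mk.inj h)), rfl⟩
  let ψ : V ≃ Fin (m + 2) := φ'.trans σ.symm
  have hφ' : ∀ v, (φ' v : ℕ) = φ v := fun v => rfl
  have hψ : ∀ v, φ v = secondPath m (ψ v) := fun v => by
    have : σ (ψ v) = φ' v := by simp [ψ]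
    rw [← hφ', ← this]
    rfl
  let K₁ := (pathGraph (m + 2)).comap φ'
  let K₂ := (pathGraph (m + 2)).comap ψ
  have h₁ : ∀ x y, K₁.Adj x y → φ x + 1 = φ y ∨ φ y + 1 = φ x := fun x y h => pathGraph_adj.1 h
  have h₂ : ∀ x y, K₂.Adj x y → (HubEdge m (φ x) (φ y) ∨ HubEdge m (φ y) (φ x)) ∧
      φ x + 1 ≠ φ y ∧ φ y + 1 ≠ φ x ∧
      ¬ StarEdge m b (φ x) (φ y) ∧ ¬ StarEdge m b (φ y) (φ x) := by
    intro x y h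
    have hx := (ψ x).2
    have hy := (ψ y).2
    rcases pathGraph_adj.1 h with h | h
    · exact secondPath_succ hm hb hbm hpar (t := ψ x) (by omega) (hψ x) (h ▸ hψ y)
    · obtain ⟨a1, a2, a3, a4, a5⟩ :=
        secondPath_succ hm hb hbm hpar (t := ψ y) (by omega) (hψ y) (h ▸ hψ x)
      exact ⟨a1.symm, a3, a2, a5, a4⟩
  -- The vertex set of the host is that of `T`, so `T` is its own copy, and the paths are pulled
  -- back along the labelling `φ'` and along `ψ`, the position of a vertex in the second path.
  refine ⟨hubGraph m φ, isOnePlanar_hubGraph hm hφ hle, ![K₁, K₂, T], ?_, ?_, ?_⟩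
  · intro i
    fin_cases i
    · intro x y h
      have := h₁ x y h
      have := hle x
      have := hle y
      change HubEdge m (φ x) (φ y) ∨ HubEdge m (φ y) (φ x)
      unfold HubEdge
      omega
    · exact fun x y h => (h₂ x y h).1
    · intro x y h
      have := hT x y h
      have := hle x
      have := hle y
      change HubEdge m (φ x) (φ y) ∨ HubEdge m (φ y) (φ x)
      unfold StarEdge at *
      unfold HubEdge
      omega
  · intro i
    fin_cases i
    · exact ⟨e₁.trans (SimpleGraph.Iso.comap φ' (pathGraph (m + 2))).symm⟩
    · exact ⟨e₂.trans (SimpleGraph.Iso.comap ψ (pathGraph (m + 2))).symm⟩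
    · exact ⟨.refl⟩
  · have d₁ : Disjoint K₁.edgeSet K₂.edgeSet := disjoint_edgeSet_iff.2 fun x y h h' => by
      have := h₁ x y h
      have := h₂ x y h'
      omega
    have d₂ : Disjoint K₁.edgeSet T.edgeSet := disjoint_edgeSet_iff.2 fun x y h h' => by
      have := h₁ x y h
      have := hT x y h'
      unfold StarEdge at this
      omega
    have d₃ : Disjoint K₂.edgeSet T.edgeSet := disjoint_edgeSet_iff.2 fun x y h h' => by
      have := h₂ x y h
      have := hT x y h'
      tauto
    intro i j hij
    fin_cases i <;> fin_cases j <;>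
    first
    | exact absurd rfl hij
    | exact d₁
    | exact d₂
    | exact d₃
    | exact d₁.symm
    | exact d₂.symm
    | exact d₃.symm

lemma Finset.exists_lt_card_injOn {V : Type*} (s : Finset V) :
    ∃ f : V → ℕ, (∀ v ∈ s, f v < s.card) ∧ ∀ v ∈ s, ∀ v' ∈ s, f v = f v' → v = v' := by
  classical
  refine ⟨fun v => if h : v ∈ s then s.equivFin ⟨v, h⟩ else 0, fun v hv => ?_, ?_⟩
  · simp [hv]
  · intro v hv v' hv' h
    simp only [hv, hv', dite_true] at h
    exact congrArg Subtype.val (s.equivFin.injective (Fin.ext h))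

/-! ### Double stars: labelling and sufficiency. -/

/-- `T` is a double star with hubs `u` and `w`. -/
structure IsDoubleStar {V : Type*} (T : SimpleGraph V) (u w : V) : Prop where
  adj : T.Adj u w
  hub_of_adj : ∀ x y, T.Adj x y → x = u ∨ x = w ∨ y = u ∨ y = w
  adj_iff : ∀ v, T.Adj u v ↔ ¬ T.Adj w v

namespace IsDoubleStar

lemma symm {V : Type*} {T : SimpleGraph V} {u w : V} (h : IsDoubleStar T u w) : IsDoubleStar T w u where
  adj := h.adj.symm
  hub_of_adj x y hxy := by have := h.hub_of_adj x y hxy; tauto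
  adj_iff v := by have := h.adj_iff v; tauto

variable {V : Type*} [Fintype V] {P₁ P₂ T : SimpleGraph V} [DecidableRel T.Adj] {u w : V}

/-- The neighbourhoods of the hubs partition the vertex set; each hub lies in the neighbourhood of
the other. -/
lemma card_eq (h : IsDoubleStar T u w) : Fintype.card V = T.degree u + T.degree w := by
  classical
  have : T.neighborFinset w = (T.neighborFinset u)ᶜ := by
    ext v
    simp [h.adj_iff v]
  rw [← card_neighborFinset_eq_degree, ← card_neighborFinset_eq_degree, this,
    Finset.card_add_card_compl]

lemma exists_labels (h : IsDoubleStar T u w) {m b : ℕ} (hb : T.degree w = b + 1)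
    (hm : T.degree u + b = m + 1) :
    ∃ φ : V → ℕ, Function.Injective φ ∧ (∀ v, φ v ≤ m + 1) ∧
      ∀ x y, T.Adj x y → StarEdge m b (φ x) (φ y) ∨ StarEdge m b (φ y) (φ x) := by
  classical
  obtain ⟨f, hf, hf'⟩ := Finset.exists_lt_card_injOn ((T.neighborFinset w).erase u)
  obtain ⟨g, hg, hg'⟩ := Finset.exists_lt_card_injOn ((T.neighborFinset u).erase w)
  rw [Finset.card_erase_of_mem (by simpa using h.adj.symm), card_neighborFinset_eq_degree] at hf
  rw [Finset.card_erase_of_mem (by simpa using h.adj), card_neighborFinset_eq_degree] at hg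
  simp only [Finset.mem_erase, mem_neighborFinset] at hf hf' hg hg'
  -- `f` and `g` number the leaves at `w` and at `u` from zero; the shifts by `1` and `1 + b` place
  -- them in `1, …, b` and `b + 1, …, m`.
  let φ : V → ℕ := fun v =>
    if v = u then 0 else if v = w then m + 1 else if T.Adj w v then 1 + f v else 1 + b + g v
  have huw := h.adj.ne
  have hbm : b ≤ m := by
    have : 0 < T.degree u := (T.degree_pos_iff_exists_adj u).2 ⟨w, h.adj⟩
    omega
  have φu : φ u = 0 := by simp [φ]
  have φw : φ w = m + 1 := by simp [φ, huw.symm]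
  have φB : ∀ v, v ≠ u → T.Adj w v → φ v = 1 + f v ∧ f v < b := fun v hv hw => by
    have := hf v ⟨hv, hw⟩
    exact ⟨by simp [φ, hv, hw, hw.ne'], by omega⟩
  have φA : ∀ v, v ≠ w → T.Adj u v → φ v = 1 + b + g v ∧ 1 + b + g v ≤ m := fun v hv hu => by
    have := hg v ⟨hv, hu⟩
    exact ⟨by simp [φ, hv, (h.adj_iff v).1 hu, hu.ne'], by omega⟩
  have hcase : ∀ v, v = u ∨ v = w ∨ (v ≠ u ∧ T.Adj w v) ∨ (v ≠ w ∧ T.Adj u v) := fun v => by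
    have := h.adj_iff v
    tauto
  have hedge : ∀ x y, (x = u ∨ x = w) → T.Adj x y →
      StarEdge m b (φ x) (φ y) ∨ StarEdge m b (φ y) (φ x) := by
    rintro x y (rfl | rfl) hxy
    · by_cases hy : y = w
      · subst hy
        rw [φu, φw]
        exact .inl (.inl ⟨rfl, rfl⟩)
      · have := φA y hy hxy
        rw [φu]
        exact .inl (.inr (.inl ⟨rfl, by omega⟩))
    · by_cases hy : y = u
      · subst hy
        rw [φu, φw]
        exact .inr (.inl ⟨rfl, rfl⟩)
      · have := φB y hy hxy
        rw [φw]
        exact .inr (.inr (.inr ⟨rfl, by omega, by omega⟩))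
  refine ⟨φ, ?_, ?_, ?_⟩
  · intro x y hxy
    rcases hcase x with rfl | rfl | ⟨h1, h2⟩ | ⟨h1, h2⟩ <;>
    rcases hcase y with rfl | rfl | ⟨h3, h4⟩ | ⟨h3, h4⟩
    · rfl
    · omega
    · have := φB _ h3 h4; omega
    · have := φA _ h3 h4; omega
    · omega
    · rfl
    · have := φB _ h3 h4; omega
    · have := φA _ h3 h4; omega
    · have := φB _ h1 h2; omega
    · have := φB _ h1 h2; omega
    · exact hf' _ ⟨h1, h2⟩ _ ⟨h3, h4⟩ (by have := φB _ h1 h2; have := φB _ h3 h4; omega)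
    · have := φB _ h1 h2; have := φA _ h3 h4; omega
    · have := φA _ h1 h2; omega
    · have := φA _ h1 h2; omega
    · have := φA _ h1 h2; have := φB _ h3 h4; omega
    · exact hg' _ ⟨h1, h2⟩ _ ⟨h3, h4⟩ (by have := φA _ h1 h2; have := φA _ h3 h4; omega)
  · intro v
    rcases hcase v with rfl | rfl | ⟨h1, h2⟩ | ⟨h1, h2⟩
    · omega
    · omega
    · have := φB _ h1 h2; omega
    · have := φA _ h1 h2; omega
  · intro x y hxy
    rcases h.hub_of_adj x y hxy with h' | h' | h' | h'
    · exact hedge x y (.inl h') hxy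
    · exact hedge x y (.inr h') hxy
    · exact (hedge y x (.inl h') hxy.symm).symm
    · exact (hedge y x (.inr h') hxy.symm).symm

lemma admitsOnePlanarPacking_of_parity (h : IsDoubleStar T u w) (hP₁ : IsPathGraph P₁)
    (hP₂ : IsPathGraph P₂) (hu : 3 ≤ T.degree u) (hw : 3 ≤ T.degree w)
    (hpar : Fintype.card V % 2 = 0 ∨ 4 ≤ T.degree w) :
    AdmitsOnePlanarPacking ![P₁, P₂, T] := by
  have hcard := h.card_eq
  obtain ⟨b, hb⟩ : ∃ b, T.degree w = b + 1 := ⟨T.degree w - 1, by omega⟩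
  obtain ⟨m, hm⟩ : ∃ m, T.degree u + b = m + 1 := ⟨T.degree u + b - 1, by omega⟩
  obtain ⟨φ, hφ, hle, hT⟩ := h.exists_labels hb hm
  exact admitsOnePlanarPacking_of_labels (b := b) (by omega) (by omega) (by omega) (by omega)
    (by omega) hφ hle hP₁ hP₂ hT

lemma admitsOnePlanarPacking (h : IsDoubleStar T u w) (hP₁ : IsPathGraph P₁)
    (hP₂ : IsPathGraph P₂) (hu : 3 ≤ T.degree u) (hw : 3 ≤ T.degree w) :
    AdmitsOnePlanarPacking ![P₁, P₂, T] := by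
  have hcard := h.card_eq
  by_cases hpar : Fintype.card V % 2 = 0 ∨ 4 ≤ T.degree w
  · exact h.admitsOnePlanarPacking_of_parity hP₁ hP₂ hu hw hpar
  -- Here `n` is odd and `deg w = 3`, so `deg u = n - 3` is even and hence at least 4: exchanging
  -- the hubs restores the parity condition.
  · exact h.symm.admitsOnePlanarPacking_of_parity hP₁ hP₂ hw hu (by omega)

end IsDoubleStar

/-! ### The degree bound forced by a packing. -/

/-- The image of `v` has a neighbour in each path; by edge-disjointness these two, the images of the
neighbours of `v` in `T` and the image of `v` itself are `deg v + 3` distinct vertices. -/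
lemma degree_add_three_le_of_packing {V : Type*} [Fintype V] {P₁ P₂ T : SimpleGraph V}
    [DecidableRel T.Adj] (hP₁ : IsPathGraph P₁) (hP₂ : IsPathGraph P₂)
    (hV : 2 ≤ Fintype.card V) (h : AdmitsOnePlanarPacking ![P₁, P₂, T]) (v : V) :
    T.degree v + 3 ≤ Fintype.card V := by
  classical
  obtain ⟨H, -, K, -, hK, hdis⟩ := h
  obtain ⟨f⟩ : Nonempty (P₁ ≃g K 0) := hK 0
  obtain ⟨g⟩ : Nonempty (P₂ ≃g K 1) := hK 1
  obtain ⟨e⟩ : Nonempty (T ≃g K 2) := hK 2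
  obtain ⟨c, hc⟩ : ∃ c, (K 0).Adj (e v) c := by
    obtain ⟨c, hc⟩ := hP₁.exists_adj hV (f.symm (e v))
    exact ⟨f c, by simpa using f.map_adj_iff.2 hc⟩
  obtain ⟨d, hd⟩ : ∃ d, (K 1).Adj (e v) d := by
    obtain ⟨d, hd⟩ := hP₂.exists_adj hV (g.symm (e v))
    exact ⟨g d, by simpa using g.map_adj_iff.2 hd⟩
  have d01 := disjoint_edgeSet_iff.1 (hdis (show (0 : Fin 3) ≠ 1 by decide))
  have d02 := disjoint_edgeSet_iff.1 (hdis (show (0 : Fin 3) ≠ 2 by decide))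
  have d12 := disjoint_edgeSet_iff.1 (hdis (show (1 : Fin 3) ≠ 2 by decide))
  set s := (T.neighborFinset v).image e with hs
  have hmem : ∀ x ∈ s, (K 2).Adj (e v) x := by
    intro x hx
    obtain ⟨y, hy, rfl⟩ := Finset.mem_image.1 hx
    exact e.map_adj_iff.2 (by simpa using hy)
  have h1 : c ∉ s := fun hx => d02 _ _ hc (hmem _ hx)
  have h2 : d ∉ insert c s := by
    rw [Finset.mem_insert, not_or]
    exact ⟨fun hx => d01 _ _ hc (hx ▸ hd), fun hx => d12 _ _ hd (hmem _ hx)⟩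
  have h3 : e v ∉ insert d (insert c s) := by
    simp only [Finset.mem_insert, not_or]
    exact ⟨hd.ne, hc.ne, fun hx => (hmem _ hx).ne rfl⟩
  have hcard := Finset.card_le_univ (insert (e v) (insert d (insert c s)))
  rw [Finset.card_insert_of_notMem h3, Finset.card_insert_of_notMem h2,
    Finset.card_insert_of_notMem h1, hs, Finset.card_image_of_injective _ e.injective,
    card_neighborFinset_eq_degree] at hcard
  omega

/-! ### From a backbone on four vertices to a double star. -/

/-- In a connected graph with a vertex of degree other than one, two leaves are not adjacent. -/
lemma not_adj_of_isLeaf {V : Type*} {T : SimpleGraph V} [T.LocallyFinite] (hT : T.Connected)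
    {x y z : V} (hx : IsLeaf T x) (hy : IsLeaf T y) (hz : ¬ IsLeaf T z) : ¬ T.Adj x y := by
  intro hxy
  have hx' := (degree_eq_one_iff_existsUnique_adj.1 hx)
  have hy' := (degree_eq_one_iff_existsUnique_adj.1 hy)
  -- Two adjacent leaves form a whole connected component: no walk from `x` leaves `{x, y}`.
  have key : z = x ∨ z = y := by
    have hr := (reachable_iff_reflTransGen x z).1 (hT.preconnected x z)
    clear hz
    induction hr with
    | refl => exact .inl rfl
    | tail _ hbc ih =>
      rcases ih with rfl | rfl
      · exact .inr (hx'.unique hbc hxy)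
      · exact .inl (hy'.unique hbc hxy.symm)
  rcases key with rfl | rfl
  · exact hz hx
  · exact hz hy

lemma IsBackbone.exists_isDoubleStar {V : Type*} {T : SimpleGraph V} [T.LocallyFinite]
    (hT : T.IsTree) {a b : V} {p : T.Walk a b} (hp : IsBackbone T p)
    (hp4 : p.support.length = 4) :
    ∃ u w, IsDoubleStar T u w := by
  obtain ⟨hpath, ha, hb, hab, hsup⟩ := hp
  obtain ⟨u, w, hadj, hu, hw, hspine⟩ : ∃ u w, T.Adj u w ∧ ¬ IsLeaf T u ∧ ¬ IsLeaf T w ∧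
      ∀ v, IsLeaf T v ∨ v = u ∨ v = w := by
    cases p with
    | nil => simp at hp4
    | @cons _ u _ h1 p =>
    cases p with
    | nil => simp at hp4
    | @cons _ w _ h2 p =>
    cases p with
    | nil => simp at hp4
    | @cons _ c _ h3 p =>
    cases p with
    | cons h4 p => simp at hp4
    | nil =>
    have hnd := hpath.support_nodup
    simp only [Walk.support_cons, Walk.support_nil, List.nodup_cons, List.mem_cons,
      List.not_mem_nil, or_false, not_or] at hnd
    simp only [Walk.support_cons, Walk.support_nil, List.mem_cons,
      List.not_mem_nil, or_false] at hsup
    obtain ⟨⟨n1, n2, n3⟩, ⟨n4, n5⟩, n6, -⟩ := hnd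
    refine ⟨u, w, h2, ?_, ?_, ?_⟩
    · rcases (hsup u).1 (by simp) with h | h | h
      · exact absurd h.symm n1
      · exact absurd h n5
      · exact h
    · rcases (hsup w).1 (by simp) with h | h | h
      · exact absurd h.symm n2
      · exact absurd h n6
      · exact h
    · intro v
      by_cases hv : IsLeaf T v
      · exact .inl hv
      · rcases (hsup v).2 (.inr (.inr hv)) with rfl | h | h | rfl
        · exact absurd ha hv
        · exact .inr (.inl h)
        · exact .inr (.inr h)
        · exact absurd hb hv
  have hhub : ∀ x y, T.Adj x y → x = u ∨ x = w ∨ y = u ∨ y = w := by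
    intro x y hxy
    rcases hspine x with hx | hx | hx
    · rcases hspine y with hy | hy
      · exact absurd hxy (not_adj_of_isLeaf hT.connected hx hy hu)
      · exact .inr (.inr hy)
    · exact .inl hx
    · exact .inr (.inl hx)
  refine ⟨u, w, ⟨hadj, hhub, fun v => ?_⟩⟩
  -- A leaf has a single neighbour, hence is not joined to both hubs; that neighbour is a hub, since
  -- every edge meets one. The hubs are adjacent to each other and not to themselves.
  rcases hspine v with hv | rfl | rfl
  · obtain ⟨c, hc, huniq⟩ := degree_eq_one_iff_existsUnique_adj.1 hv
    simp only at huniq hc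
    constructor
    · intro h1 h2
      exact hadj.ne ((huniq u h1.symm).trans (huniq w h2.symm).symm)
    · intro h
      have hvu : v ≠ u := fun h' => hu (h' ▸ hv)
      have hvw : v ≠ w := fun h' => hw (h' ▸ hv)
      rcases hhub v c hc with h' | h' | rfl | rfl
      · exact absurd h' hvu
      · exact absurd h' hvw
      · exact hc.symm
      · exact absurd hc.symm h
  · simp [hadj.symm]
  · simp [hadj]

theorem theorem3 {V : Type*} [Fintype V] (P₁ P₂ T : SimpleGraph V) [DecidableRel T.Adj]
    (hP₁ : IsPathGraph P₁) (hP₂ : IsPathGraph P₂) (hT : IsCaterpillar T)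
    {a b : V} (p : T.Walk a b) (hp : IsBackbone T p) (hp4 : p.support.length = 4) :
    AdmitsOnePlanarPacking ![P₁, P₂, T] ↔
      6 ≤ Fintype.card V ∧ ∀ v : V, T.degree v + 3 ≤ Fintype.card V := by
  obtain ⟨u, w, h⟩ := hp.exists_isDoubleStar hT.1 hp4
  have hcard := h.card_eq
  constructor
  · intro hpack
    have hV : 2 ≤ Fintype.card V := Fintype.one_lt_card_iff.2 ⟨u, w, h.adj.ne⟩
    have hdeg := degree_add_three_le_of_packing hP₁ hP₂ hV hpack
    have := hdeg u
    have := hdeg w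
    exact ⟨by omega, hdeg⟩
  · rintro ⟨-, hdeg⟩
    have := hdeg u
    have := hdeg w
    -- Since `n = deg u + deg w`, the upper bound `n - 3` on one hub degree is the lower bound 3 on
    -- the other.
    exact h.admitsOnePlanarPacking hP₁ hP₂ (by omega) (by omega)
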